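/- Let $\mathcal{A}=\mathbb{Z}[q,q^{-1}]\subset\mathbb{Q}(q)$, with quantum integers $\{n\}_q=q^{n-1}+q^{n-3}+\dots+q^{1-n}$, factorials $\{n\}_q!=\{n\}_q\cdots\{1\}_q$ and quantum binomial coefficients $\left\{{n\atop k}\right\}_q=\frac{\{n\}_q!}{\{k\}_q!\{n-k\}_q!}\in\mathcal{A}$ for $0\le k\le n$, and $\left\{{n\atop k}\right\}_q=0$ for $n\ge 0$ and $k<0$ or $k>n$. Let $U_q(\mathfrak{sl}_2)$ be the unital associative $\mathbb{Q}(q)$-algebra with generators $E,F,K,K^{-1}$ and relations $KK^{-1}=K^{-1}K=1$, $KEK^{-1}=q^2E$, $KFK^{-1}=q^{-2}F$, $EF-FE=\frac{K-K^{-1}}{q-q^{-1}}$. For $c\in\mathbb{Z}$ and $t\in\mathbb{N}_0$ put $$[K;c]=\frac{q^cK-q^{-c}K^{-1}}{q-q^{-1}},\qquad \left[{K;c\atop t}\right]=\frac{[K;c][K;c-1]\cdots[K;c-t+1]}{\{t\}_q!},$$ and let $U^0_{\mathcal{A}}(\mathfrak{sl}_2)$, the Cartan subalgebra of Lusztig's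 integral form, be the $\mathcal{A}$-subalgebra of $U_q(\mathfrak{sl}_2)$ generated by $K$, $K^{-1}$ and the elements $\left[{K;0\atop t}\right]$ for $t\in\mathbb{N}_0$. Theorem. As a unital associative $\mathcal{A}$-algebra, $U^0_{\mathcal{A}}(\mathfrak{sl}_2)$ is presented by the generators $\left[{K;c\atop t}\right]$ ($c\in\mathbb{Z}$, $t\in\mathbb{N}_0$), where $\left[{K;c\atop 0}\right]=1$ for all $c\in\mathbb{Z}$, and the following relations: (1) for all $b,c\in\mathbb{Z}$ and $s,t\in\mathbb{N}_0$ with $t-c+b\ge 0$ and $s-b+c\ge 0$, $$\left[{K;c\atop t}\right]\left[{K;b\atop s}\right]=\sum_{i\in\mathbb{Z}}\left\{{t-c+b\atop i-c}\right\}_q\left\{{s-b+c\atop i-b}\right\}_q\left[{K;i\atop t+s}\right]$$ (a finite sum, with non-zero terms only for $\max(b,c)\le i\le\min(t+b,s+c)$); (2) for all $c\in\mathbb{Z}$ and $t\ge 1$, $$\left[{K;c+2\atop t}\right]=(q^t+q^{-t})\left[{K;c+1\atop t}\right]-\left[{K;c\atop t}\right]+\left[{K;c\atop t-2}\right],$$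 where the last term is read as $0$ if $t=1$. That is, the $\mathcal{A}$-algebra defined by these generators and relations is isomorphic to $U^0_{\mathcal{A}}(\mathfrak{sl}_2)$ by an isomorphism that sends each generator to the element of the same name. -/

import Mathlib

open scoped LaurentPolynomial

namespace QuantumCartan

noncomputable section

/-! ### The ground rings -/

/-- The ring `𝒜 = ℤ[q, q⁻¹]`; the power `q ^ n` is `LaurentPolynomial.T n`. -/
abbrev A : Type := ℤ[T;T⁻¹]

/-- The field `ℚ(q)`. -/
abbrev Qq : Type := RatFunc ℚ

/-- The indeterminate `q` of `ℚ(q)`. -/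
def q : Qq := RatFunc.X

theorem q_ne_zero : q ≠ 0 := RatFunc.X_ne_zero

/-- The inclusion `ℤ[q, q⁻¹] → ℚ(q)`, which sends `q` to `q`. -/
def inclusion : A →+* Qq :=
  LaurentPolynomial.eval₂ (Int.castRingHom Qq) (Units.mk0 q q_ne_zero)

instance instAlgebraAQq : Algebra A Qq := inclusion.toAlgebra

theorem algebraMap_T (n : ℤ) : algebraMap A Qq (LaurentPolynomial.T n) = q ^ n := by
  change LaurentPolynomial.eval₂ _ _ _ = _
  simp

/-! ### Quantum integers, factorials and binomial coefficients -/

/-- The quantum integer `{n} = q ^ (n - 1) + q ^ (n - 3) + ⋯ + q ^ (1 - n)`. -/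
def quantumInt (n : ℕ) : A :=
  ∑ j ∈ Finset.range n, LaurentPolynomial.T ((n : ℤ) - 1 - 2 * (j : ℤ))

/-- The quantum factorial `{n}! = {n} {n - 1} ⋯ {1}`. -/
def quantumFactorial (n : ℕ) : A :=
  ∏ j ∈ Finset.range n, quantumInt (j + 1)

/-- The quantum binomial coefficient as a Laurent polynomial, by the Pascal recursion. It is
`{n}! / ({k}! {n - k}!)` for `k ≤ n` and `0` for `n < k`: see `quantumBinomial_mul` and
`quantumBinomial_of_lt`. -/
def quantumBinomial : ℕ → ℕ → A
  | _, 0 => 1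
  | 0, _ + 1 => 0
  | n + 1, k + 1 =>
      LaurentPolynomial.T ((k : ℤ) + 1) * quantumBinomial n (k + 1) +
        LaurentPolynomial.T ((k : ℤ) - (n : ℤ)) * quantumBinomial n k

theorem quantumBinomial_zero_right (n : ℕ) : quantumBinomial n 0 = 1 := by
  cases n <;> rfl

theorem quantumBinomial_of_lt : ∀ n k : ℕ, n < k → quantumBinomial n k = 0
  | _, 0, h => absurd h (Nat.not_lt_zero _)
  | 0, _ + 1, _ => rfl
  | n + 1, k + 1, h => by
      rw [quantumBinomial, quantumBinomial_of_lt n (k + 1) (by omega),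
        quantumBinomial_of_lt n k (by omega)]
      simp

theorem quantumInt_mul (n : ℕ) :
    quantumInt n * (LaurentPolynomial.T 1 - LaurentPolynomial.T (-1)) =
      LaurentPolynomial.T (n : ℤ) - LaurentPolynomial.T (-(n : ℤ)) := by
  have key : ∀ m : ℕ, (∑ j ∈ Finset.range m, LaurentPolynomial.T ((n : ℤ) - 1 - 2 * (j : ℤ)) : A) *
      (LaurentPolynomial.T 1 - LaurentPolynomial.T (-1)) =
      LaurentPolynomial.T (n : ℤ) - LaurentPolynomial.T ((n : ℤ) - 2 * (m : ℤ)) := by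
    intro m
    induction m with
    | zero => simp
    | succ m ih =>
      rw [Finset.sum_range_succ, add_mul, ih, mul_sub, ← LaurentPolynomial.T_add,
        ← LaurentPolynomial.T_add]
      push_cast
      ring_nf
  have h := key n
  rw [quantumInt, h]
  ring_nf

theorem T_sub_T_ne_zero :
    (LaurentPolynomial.T 1 - LaurentPolynomial.T (-1) : A) ≠ 0 := by
  intro h
  have h1 := congrArg LaurentPolynomial.degree (sub_eq_zero.mp h)
  rw [LaurentPolynomial.degree_T, LaurentPolynomial.degree_T] at h1
  exact absurd (WithBot.coe_injective h1) (by norm_num)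

theorem quantumInt_add (a b : ℕ) :
    quantumInt (a + b) =
      LaurentPolynomial.T (b : ℤ) * quantumInt a + LaurentPolynomial.T (-(a : ℤ)) * quantumInt b := by
  apply mul_right_cancel₀ T_sub_T_ne_zero
  rw [quantumInt_mul, add_mul, mul_assoc, mul_assoc, quantumInt_mul, quantumInt_mul, mul_sub,
    mul_sub, ← LaurentPolynomial.T_add, ← LaurentPolynomial.T_add, ← LaurentPolynomial.T_add,
    ← LaurentPolynomial.T_add]
  push_cast
  ring_nf

theorem quantumFactorial_succ (n : ℕ) :
    quantumFactorial (n + 1) = quantumFactorial n * quantumInt (n + 1) :=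
  Finset.prod_range_succ _ _

theorem quantumBinomial_self (n : ℕ) : quantumBinomial n n = 1 := by
  induction n with
  | zero => rfl
  | succ n ih =>
    rw [quantumBinomial, ih, quantumBinomial_of_lt n (n + 1) (by omega)]
    simp

/-- The defining formula `{n}! / ({k}! {n - k}!)` with `n = k + l`. -/
theorem quantumBinomial_mul (k l : ℕ) :
    quantumBinomial (k + l) k * (quantumFactorial k * quantumFactorial l) =
      quantumFactorial (k + l) := by
  induction k generalizing l with
  | zero => simp [quantumBinomial_zero_right, quantumFactorial]
  | succ k ihk =>
    induction l with
    | zero => simp [quantumBinomial_self, quantumFactorial]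
    | succ l ihl =>
      have e1 : k + 1 + (l + 1) = (k + l + 1) + 1 := by omega
      have h1 := ihk (l + 1)
      have h2 := ihl
      rw [show k + (l + 1) = k + l + 1 by omega] at h1
      rw [show k + 1 + l = k + l + 1 by omega] at h2
      have h3 := quantumInt_add (l + 1) (k + 1)
      rw [show l + 1 + (k + 1) = k + l + 1 + 1 by omega] at h3
      rw [e1, quantumBinomial, quantumFactorial_succ (k + l + 1), h3]
      have e2 : (k : ℤ) - ((k + l + 1 : ℕ) : ℤ) = -((l + 1 : ℕ) : ℤ) := by push_cast; ring
      have e3 : ((k + 1 : ℕ) : ℤ) = (k : ℤ) + 1 := by push_cast; ring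
      rw [e2, e3, quantumFactorial_succ k, quantumFactorial_succ l]
      rw [quantumFactorial_succ l] at h1
      rw [quantumFactorial_succ k] at h2
      linear_combination
        LaurentPolynomial.T ((k : ℤ) + 1) * quantumInt (l + 1) * h2 +
          LaurentPolynomial.T (-((l + 1 : ℕ) : ℤ)) * quantumInt (k + 1) * h1

/-- The quantum binomial coefficient for a top entry `n ≥ 0` and any integer as bottom entry: it
vanishes if the bottom entry is negative. (It is only used for `n ≥ 0`.) -/
def quantumBinomialInt (n k : ℤ) : A :=
  if 0 ≤ k then quantumBinomial n.toNat k.toNat else 0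

/-! ### The quantum group `U_q(sl₂)` -/

/-- The generators `E`, `F`, `K`, `K⁻¹`. -/
inductive Gen : Type
  | E | F | K | Kinv

/-- The defining relations of `U_q(sl₂)` in the free associative algebra over `ℚ(q)`. -/
inductive UqRel : FreeAlgebra Qq Gen → FreeAlgebra Qq Gen → Prop
  | K_mul_Kinv : UqRel (FreeAlgebra.ι Qq Gen.K * FreeAlgebra.ι Qq Gen.Kinv) 1
  | Kinv_mul_K : UqRel (FreeAlgebra.ι Qq Gen.Kinv * FreeAlgebra.ι Qq Gen.K) 1
  | K_E : UqRel
      (FreeAlgebra.ι Qq Gen.K * FreeAlgebra.ι Qq Gen.E * FreeAlgebra.ι Qq Gen.Kinv)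
      (q ^ (2 : ℤ) • FreeAlgebra.ι Qq Gen.E)
  | K_F : UqRel
      (FreeAlgebra.ι Qq Gen.K * FreeAlgebra.ι Qq Gen.F * FreeAlgebra.ι Qq Gen.Kinv)
      (q ^ (-2 : ℤ) • FreeAlgebra.ι Qq Gen.F)
  | E_F : UqRel
      (FreeAlgebra.ι Qq Gen.E * FreeAlgebra.ι Qq Gen.F -
        FreeAlgebra.ι Qq Gen.F * FreeAlgebra.ι Qq Gen.E)
      ((q - q⁻¹)⁻¹ • (FreeAlgebra.ι Qq Gen.K - FreeAlgebra.ι Qq Gen.Kinv))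

/-- The quantum group `U_q(sl₂)`, a unital associative algebra over `ℚ(q)`, and by restriction of
scalars over `ℤ[q, q⁻¹]`. -/
abbrev Uq : Type := RingQuot UqRel

/-- The image of a generator in `U_q(sl₂)`. -/
def Uq.gen (x : Gen) : Uq := RingQuot.mkAlgHom Qq UqRel (FreeAlgebra.ι Qq x)

/-- The element `K` of `U_q(sl₂)`. -/
def K : Uq := Uq.gen Gen.K

/-- The element `K⁻¹` of `U_q(sl₂)`. -/
def Kinv : Uq := Uq.gen Gen.Kinv

/-- The element `[K; a] = (q ^ a K - q ^ (-a) K⁻¹) / (q - q⁻¹)`. -/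
def bracket (a : ℤ) : Uq :=
  (q - q⁻¹)⁻¹ • (q ^ a • K - q ^ (-a) • Kinv)

/-- Lusztig's element `[K; c choose t] = [K; c] [K; c - 1] ⋯ [K; c - t + 1] / {t}!`. -/
def lusztig (c : ℤ) (t : ℕ) : Uq :=
  (algebraMap A Qq (quantumFactorial t))⁻¹ •
    ((List.range t).map fun i => bracket (c - (i : ℤ))).prod

/-- The Cartan subalgebra `U⁰_𝒜(sl₂)` of Lusztig's integral form: the `𝒜`-subalgebra of `U_q(sl₂)`
generated by `K`, `K⁻¹` and the elements `[K; 0 choose t]`. -/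
def cartan : Subalgebra A Uq :=
  Algebra.adjoin A ({K, Kinv} ∪ Set.range fun t : ℕ => lusztig 0 t)

/-! ### The algebra given by generators and relations -/

/-- The free generator `x_{c,t}`, which stands for `[K; c choose t]`. -/
def freeGen (c : ℤ) (t : ℕ) : FreeAlgebra A (ℤ × ℕ) := FreeAlgebra.ι A (c, t)

/-- The relations, in the free associative `𝒜`-algebra on the symbols `x_{c,t}`. In `mul`, the
summand vanishes for all integers `i` outside of the given interval, so this is the sum over all
integers `i`. In `three_term`, the symbol `x_{c,t-2}` is read as `0` if `t = 1`. -/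
inductive CartanRel : FreeAlgebra A (ℤ × ℕ) → FreeAlgebra A (ℤ × ℕ) → Prop
  | one (c : ℤ) : CartanRel (freeGen c 0) 1
  | mul (b c : ℤ) (s t : ℕ) (h₁ : 0 ≤ (t : ℤ) - c + b) (h₂ : 0 ≤ (s : ℤ) - b + c) :
      CartanRel (freeGen c t * freeGen b s)
        (∑ i ∈ Finset.Icc (max b c) (min ((t : ℤ) + b) ((s : ℤ) + c)),
          (quantumBinomialInt ((t : ℤ) - c + b) (i - c) *
            quantumBinomialInt ((s : ℤ) - b + c) (i - b)) • freeGen i (t + s))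
  | three_term (c : ℤ) (t : ℕ) (ht : 1 ≤ t) :
      CartanRel (freeGen (c + 2) t)
        ((LaurentPolynomial.T (t : ℤ) + LaurentPolynomial.T (-(t : ℤ)) : A) • freeGen (c + 1) t -
          freeGen c t + if 2 ≤ t then freeGen c (t - 2) else 0)

/-- The `𝒜`-algebra presented by the generators `x_{c,t}` and the relations `CartanRel`. -/
abbrev PresentedCartan : Type := RingQuot CartanRel

/-- The class of the generator `x_{c,t}`. -/
def PresentedCartan.gen (c : ℤ) (t : ℕ) : PresentedCartan :=
  RingQuot.mkAlgHom A CartanRel (freeGen c t)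

end

end QuantumCartan

/-!
Everything is compared inside the commutative ring `L = ℚ(q)[K, K⁻¹]`. The theorem follows from three
facts.

* `L` embeds into `U_q(sl₂)` (`laurentToUq_injective`). To see this, let `U_q(sl₂)` act on functions
  `ℤ → L` by a universal weight module in which `K` acts on the values at `n` as `q ^ (-2 n) K`; on
  the values at `0` a Laurent polynomial in `K` then acts as multiplication with itself, so it can be
  recovered from its image in `U_q(sl₂)`.

* The relations hold in `L`. The three-term relation is an identity between products of two
  brackets. The product formula (`laurentLusztig_mul`) is proved by induction on `t`: the brackets
  `[K; a]` span a space of rank two, so the additional factor `[K; c - t]` is a combination of the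
  two brackets that extend `[K; i choose t + s]` to `[K; i choose t + s + 1]` and
  `[K; i + 1 choose t + s + 1]`, and a weighted Pascal rule for products of two quantum binomial
  coefficients collects the terms.

* The resulting homomorphism from the presented algebra to `L` is injective
  (`toLaurent_injective`). By the three-term relation every generator is a combination of the
  `x_{0,t}` and `x_{1,t}`, and the product formula applies to any two of these, so that they span the
  presented algebra over `𝒜`. Their images `[K; 0 choose t]` and `[K; 1 choose t]` are Laurent
  polynomials with exponents between `-t` and `t`; raising the upper parameter by one multiplies the
  coefficients at `K ^ t` and `K ^ (-t)` by `q ^ t` and `q ^ (-t)`. For `t ≥ 1` the two extreme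
  coefficients therefore separate the two elements, and a descent on `t` shows that a combination
  with image zero is zero.

The image in `U_q(sl₂)` is the Cartan subalgebra since `K` and `K⁻¹` are combinations of
`[K; 0 choose 1]` and `[K; 1 choose 1]`, and since `lusztig_succ_succ` moves the upper parameter up
and down within the Cartan subalgebra.
-/

open scoped LaurentPolynomial

namespace QuantumCartan

noncomputable section

/-! ### Quantum integers and binomial coefficients in `ℚ(q)` -/

theorem inclusion_injective : Function.Injective (algebraMap A Qq) := by
  rw [injective_iff_map_eq_zero]
  intro f hf
  obtain ⟨n, p, hp⟩ := LaurentPolynomial.exists_T_pow f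
  have h1 : algebraMap A Qq (Polynomial.toLaurent p) = 0 := by rw [hp, map_mul, hf, zero_mul]
  have h2 : algebraMap A Qq (Polynomial.toLaurent p) =
      algebraMap (Polynomial ℚ) Qq (p.map (Int.castRingHom ℚ)) := by
    change LaurentPolynomial.eval₂ _ _ _ = _
    rw [LaurentPolynomial.eval₂_toLaurent]
    clear h1 hp
    induction p using Polynomial.induction_on' with
    | add p r hp hr => rw [Polynomial.eval₂_add, hp, hr, Polynomial.map_add, map_add]
    | monomial n a =>
      rw [Polynomial.eval₂_monomial, Polynomial.map_monomial, ← Polynomial.C_mul_X_pow_eq_monomial]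
      simp [q]
  rw [h2, map_eq_zero_iff _ (IsFractionRing.injective (Polynomial ℚ) Qq),
    Polynomial.map_eq_zero_iff (Int.castRingHom ℚ).injective_int] at h1
  rw [h1, map_zero] at hp
  exact ((LaurentPolynomial.isUnit_T (n : ℤ)).mul_left_eq_zero).1 hp.symm

theorem q_zpow_injective : Function.Injective fun n : ℤ => q ^ n := by
  intro m n h
  have h' : (LaurentPolynomial.T m : A) = LaurentPolynomial.T n :=
    inclusion_injective (by simpa only [algebraMap_T] using h)
  have h1 := congrArg LaurentPolynomial.degree h'
  rw [LaurentPolynomial.degree_T, LaurentPolynomial.degree_T] at h1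
  exact WithBot.coe_injective h1

theorem zpow_sub_zpow_neg_ne_zero {n : ℤ} (hn : n ≠ 0) : q ^ n - q ^ (-n) ≠ 0 := fun h => by
  have := q_zpow_injective (sub_eq_zero.1 h)
  omega

theorem q_sub_inv_ne_zero : q - q⁻¹ ≠ 0 := by
  simpa using zpow_sub_zpow_neg_ne_zero one_ne_zero

/-- The quantum integer `(q ^ n - q ^ (-n)) / (q - q⁻¹)` as an element of `ℚ(q)`, for any
integer `n`. -/
def qint (n : ℤ) : Qq := (q - q⁻¹)⁻¹ * (q ^ n - q ^ (-n))

theorem qint_ne_zero {n : ℤ} (hn : n ≠ 0) : qint n ≠ 0 :=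
  mul_ne_zero (inv_ne_zero q_sub_inv_ne_zero) (zpow_sub_zpow_neg_ne_zero hn)

@[simp] theorem qint_zero : qint 0 = 0 := by simp [qint]

@[simp] theorem qint_one : qint 1 = 1 := by simp [qint, q_sub_inv_ne_zero]

theorem algebraMap_quantumInt (n : ℕ) : algebraMap A Qq (quantumInt n) = qint n := by
  have h := congrArg (algebraMap A Qq) (quantumInt_mul n)
  simp only [map_mul, map_sub, algebraMap_T, zpow_one, zpow_neg] at h
  rw [qint, zpow_neg, ← h, mul_comm, mul_assoc, mul_inv_cancel₀ q_sub_inv_ne_zero, mul_one]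

/-- The quantum factorial as an element of `ℚ(q)`. -/
def qfact (n : ℕ) : Qq := algebraMap A Qq (quantumFactorial n)

@[simp] theorem qfact_zero : qfact 0 = 1 := by simp [qfact, quantumFactorial]

theorem qfact_succ (n : ℕ) : qfact (n + 1) = qfact n * qint (n + 1) := by
  rw [qfact, quantumFactorial_succ, map_mul, algebraMap_quantumInt, qfact]
  push_cast
  rfl

theorem qfact_ne_zero (n : ℕ) : qfact n ≠ 0 := by
  induction n with
  | zero => simp
  | succ n ih => rw [qfact_succ]; exact mul_ne_zero ih (qint_ne_zero (by omega))

/-- The quantum binomial coefficient as an element of `ℚ(q)`, with any integer as bottom entry. -/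
def qbinom (n : ℕ) (k : ℤ) : Qq := algebraMap A Qq (quantumBinomialInt n k)

theorem qbinom_of_neg (n : ℕ) {k : ℤ} (hk : k < 0) : qbinom n k = 0 := by
  rw [qbinom, quantumBinomialInt, if_neg (by omega), map_zero]

theorem qbinom_of_lt {n : ℕ} {k : ℤ} (hk : (n : ℤ) < k) : qbinom n k = 0 := by
  rw [qbinom, quantumBinomialInt, if_pos (by omega), quantumBinomial_of_lt _ _ (by omega), map_zero]

theorem qbinom_add (k l : ℕ) : qbinom (k + l) k = qfact (k + l) / (qfact k * qfact l) := by
  rw [eq_div_iff (mul_ne_zero (qfact_ne_zero k) (qfact_ne_zero l))]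
  simp only [qbinom, quantumBinomialInt, qfact, ← map_mul]
  rw [if_pos (by omega), Int.toNat_natCast, Int.toNat_natCast, quantumBinomial_mul]

@[simp] theorem qbinom_zero_right (n : ℕ) : qbinom n 0 = 1 := by
  simpa [qfact_ne_zero] using qbinom_add 0 n

@[simp] theorem qbinom_self (n : ℕ) : qbinom n n = 1 := by
  simpa [qfact_ne_zero] using qbinom_add n 0

theorem qbinom_succ_mul_sub (n : ℕ) (k : ℤ) :
    qbinom (n + 1) k * qint (n + 1 - k) = qint (n + 1) * qbinom n k := by
  rcases lt_or_ge k 0 with hk | hk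
  · simp [qbinom_of_neg _ hk]
  rcases lt_or_ge (n : ℤ) k with hn | hn
  · rw [qbinom_of_lt hn]
    rcases eq_or_lt_of_le (show (n : ℤ) + 1 ≤ k by omega) with h | h
    · simp [h]
    · rw [qbinom_of_lt (by push_cast; exact h)]; simp
  lift k to ℕ using hk
  obtain ⟨l, rfl⟩ := Nat.exists_eq_add_of_le (Int.ofNat_le.1 hn)
  have h1 := qfact_ne_zero k
  have h2 := qfact_ne_zero l
  have h3 : qint ((l : ℤ) + 1) ≠ 0 := qint_ne_zero (by omega)
  rw [qbinom_add, add_assoc, qbinom_add, ← add_assoc, qfact_succ, qfact_succ,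
    show ((k + l : ℕ) : ℤ) + 1 - k = l + 1 by push_cast; ring]
  field_simp

theorem qbinom_succ_mul (n : ℕ) (k : ℤ) :
    qbinom n (k + 1) * qint (k + 1) = qbinom n k * qint (n - k) := by
  rcases lt_or_ge k 0 with hk | hk
  · rw [qbinom_of_neg _ hk]
    rcases eq_or_lt_of_le (show k + 1 ≤ 0 by omega) with h | h
    · simp [h]
    · rw [qbinom_of_neg _ h]; simp
  rcases le_or_gt (n : ℤ) k with hn | hn
  · rw [qbinom_of_lt (show (n : ℤ) < k + 1 by omega)]
    rcases eq_or_lt_of_le hn with h | h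
    · simp [h]
    · rw [qbinom_of_lt h]; simp
  lift k to ℕ using hk
  obtain ⟨l, rfl⟩ := Nat.exists_eq_add_of_le (show k + 1 ≤ n by omega)
  have h1 := qfact_ne_zero k
  have h2 := qfact_ne_zero l
  have h3 : qint ((l : ℤ) + 1) ≠ 0 := qint_ne_zero (by omega)
  have h4 : qint ((k : ℤ) + 1) ≠ 0 := qint_ne_zero (by omega)
  have e1 := qbinom_add (k + 1) l
  have e2 := qbinom_add k (l + 1)
  rw [show k + (l + 1) = k + 1 + l by ring, qfact_succ l] at e2
  rw [qfact_succ k] at e1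
  rw [show (k : ℤ) + 1 = ((k + 1 : ℕ) : ℤ) by push_cast; rfl, e1, e2,
    show ((k + 1 + l : ℕ) : ℤ) - k = l + 1 by push_cast; ring]
  push_cast
  field_simp

theorem qbinom_succ_succ_mul (n : ℕ) (k : ℤ) :
    qbinom (n + 1) (k + 1) * qint (k + 1) = qint (n + 1) * qbinom n k := by
  rw [qbinom_succ_mul, ← qbinom_succ_mul_sub]
  push_cast
  rfl

theorem qint_mul_add_mul (m i d : ℤ) :
    qint (m - i) * qint (m + i - d) + qint i * qint (i - d) = qint (m - d) * qint m := by
  have hq := q_ne_zero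
  simp only [qint, zpow_sub₀ hq, zpow_add₀ hq, zpow_neg]
  have h1 := zpow_ne_zero m hq
  have h2 := zpow_ne_zero i hq
  have h3 := zpow_ne_zero d hq
  generalize (q - q⁻¹)⁻¹ = δ
  generalize q ^ m = x at *
  generalize q ^ i = y at *
  generalize q ^ d = z at *
  field_simp
  ring

/-- A weighted Pascal rule: the recursion in `m` for the coefficients
`{m choose i} {n choose i - d}` of the product formula. -/
theorem qbinom_mul_qbinom_recursion (m n : ℕ) (i d : ℤ) :
    qbinom m i * qbinom n (i - d) * qint (m + 1 + i - d) +
        qbinom m (i - 1) * qbinom n (i - 1 - d) * qint (n + d - (i - 1)) =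
      qint (m + 1 - d) * (qbinom (m + 1) i * qbinom n (i - d)) := by
  apply mul_left_cancel₀ (qint_ne_zero (show (m : ℤ) + 1 ≠ 0 by omega))
  have h1 := qbinom_succ_mul_sub m i
  have h2 := qbinom_succ_succ_mul m (i - 1)
  have h3 := qbinom_succ_mul n (i - 1 - d)
  have h4 := qint_mul_add_mul (m + 1) i d
  rw [sub_add_cancel] at h2
  rw [show i - 1 - d + 1 = i - d by ring, show (n : ℤ) - (i - 1 - d) = n + d - (i - 1) by ring] at h3
  linear_combination (-qbinom n (i - d) * qint (m + 1 + i - d)) * h1 -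
    qbinom n (i - 1 - d) * qint (n + d - (i - 1)) * h2 - qbinom (m + 1) i * qint i * h3 +
    qbinom (m + 1) i * qbinom n (i - d) * h4

open LaurentPolynomial (C T)

/-! ### Lusztig's elements as Laurent polynomials in `K` -/

/-- The element `[K; a]`, as a Laurent polynomial in `K = T 1` over `ℚ(q)`. -/
def laurentBracket (a : ℤ) : Qq[T;T⁻¹] :=
  C (q - q⁻¹)⁻¹ * (C (q ^ a) * T 1 - C (q ^ (-a)) * T (-1))

/-- The element `[K; c choose t]`, as a Laurent polynomial in `K = T 1` over `ℚ(q)`. -/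
def laurentLusztig (c : ℤ) (t : ℕ) : Qq[T;T⁻¹] :=
  C (qfact t)⁻¹ * ∏ i ∈ Finset.range t, laurentBracket (c - i)

@[simp] theorem laurentLusztig_zero (c : ℤ) : laurentLusztig c 0 = 1 := by simp [laurentLusztig]

theorem C_qint_mul_cancel {n : ℤ} (hn : n ≠ 0) {f g : Qq[T;T⁻¹]}
    (h : C (qint n) * f = C (qint n) * g) : f = g := by
  have := congrArg (C (qint n)⁻¹ * ·) h
  simpa [← mul_assoc, ← map_mul, inv_mul_cancel₀ (qint_ne_zero hn)] using this

theorem qint_mul_laurentLusztig_succ (c : ℤ) (t : ℕ) :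
    C (qint (t + 1)) * laurentLusztig c (t + 1) = laurentLusztig c t * laurentBracket (c - t) := by
  have h : C (qint (t + 1)) * C (qint (t + 1))⁻¹ = (1 : Qq[T;T⁻¹]) := by
    rw [← map_mul, mul_inv_cancel₀ (qint_ne_zero (by omega)), map_one]
  rw [laurentLusztig, laurentLusztig, Finset.prod_range_succ, qfact_succ, mul_inv, map_mul]
  linear_combination
    (C (qfact t)⁻¹ * (∏ i ∈ Finset.range t, laurentBracket (c - i)) * laurentBracket (c - t)) * h

theorem qint_mul_laurentLusztig_succ' (c : ℤ) (t : ℕ) :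
    C (qint (t + 1)) * laurentLusztig (c + 1) (t + 1) =
      laurentBracket (c + 1) * laurentLusztig c t := by
  have h : C (qint (t + 1)) * C (qint (t + 1))⁻¹ = (1 : Qq[T;T⁻¹]) := by
    rw [← map_mul, mul_inv_cancel₀ (qint_ne_zero (by omega)), map_one]
  have h2 : ∀ i : ℕ, c + 1 - ((i + 1 : ℕ) : ℤ) = c - i := fun i => by push_cast; ring
  rw [laurentLusztig, laurentLusztig, Finset.prod_range_succ', qfact_succ, mul_inv, map_mul]
  simp only [h2, Nat.cast_zero, sub_zero]
  linear_combination
    (C (qfact t)⁻¹ * (∏ i ∈ Finset.range t, laurentBracket (c - i)) * laurentBracket (c + 1)) * h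

/-- The values `[K; a]`, `[K; b]`, `[K; c]` are linearly dependent, since each of them is a
combination of `K` and `K⁻¹`. -/
theorem laurentBracket_mul_qint (a b c : ℤ) :
    C (qint (c - b)) * laurentBracket a =
      C (qint (c - a)) * laurentBracket b + C (qint (a - b)) * laurentBracket c := by
  have hq := q_ne_zero
  have key : ∀ ε : ℤ, ε = 1 ∨ ε = -1 → qint (c - b) * q ^ (ε * a) =
      qint (c - a) * q ^ (ε * b) + qint (a - b) * q ^ (ε * c) := by
    have h1 := zpow_ne_zero a hq
    have h2 := zpow_ne_zero b hq
    have h3 := zpow_ne_zero c hq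
    rintro ε (rfl | rfl) <;>
    · simp only [qint, zpow_sub₀ hq, zpow_neg, one_mul, neg_mul]
      generalize (q - q⁻¹)⁻¹ = δ
      generalize q ^ a = x at *
      generalize q ^ b = y at *
      generalize q ^ c = z at *
      field_simp
      ring
  have e1 := congrArg (C : Qq →+* Qq[T;T⁻¹]) (key 1 (.inl rfl))
  have e2 := congrArg (C : Qq →+* Qq[T;T⁻¹]) (key (-1) (.inr rfl))
  simp only [one_mul, neg_mul, map_mul, map_add] at e1 e2
  simp only [laurentBracket]
  linear_combination C (q - q⁻¹)⁻¹ * T 1 * e1 - C (q - q⁻¹)⁻¹ * T (-1) * e2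

/-- Multiplication with any bracket, expressed by the two extensions of `[K; c choose n]` at its ends. -/
theorem laurentLusztig_mul_bracket (c e : ℤ) (n : ℕ) :
    laurentLusztig c n * laurentBracket e =
      C (qint (c + 1 - e)) * laurentLusztig c (n + 1) +
        C (qint (e - c + n)) * laurentLusztig (c + 1) (n + 1) := by
  apply C_qint_mul_cancel (show (n : ℤ) + 1 ≠ 0 by omega)
  have h1 := qint_mul_laurentLusztig_succ c n
  have h2 := qint_mul_laurentLusztig_succ' c n
  have h3 := laurentBracket_mul_qint e (c - n) (c + 1)
  rw [show c + 1 - (c - (n : ℤ)) = n + 1 by ring, show e - (c - (n : ℤ)) = e - c + n by ring] at h3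
  linear_combination laurentLusztig c n * h3 - C (qint (c + 1 - e)) * h1 -
    C (qint (e - c + n)) * h2

theorem sum_range_add_shift {M : Type*} [AddCommMonoid M] (f g : ℕ → M) (m : ℕ)
    (hf : f (m + 1) = 0) (hg : g 0 = 0) :
    ∑ j ∈ Finset.range (m + 1), (f j + g (j + 1)) = ∑ j ∈ Finset.range (m + 2), (f j + g j) := by
  rw [Finset.sum_add_distrib, Finset.sum_add_distrib, Finset.sum_range_succ f (m + 1), hf, add_zero,
    Finset.sum_range_succ' g (m + 1), hg, add_zero]

theorem laurentLusztig_mul_consecutive (c : ℤ) (t s : ℕ) :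
    laurentLusztig c t * laurentLusztig (c - t) s =
      C (qbinom (t + s) t) * laurentLusztig c (t + s) := by
  have h : ∀ i : ℕ, c - t - i = c - ((t + i : ℕ) : ℤ) := fun i => by push_cast; ring
  have h1 : (qfact t)⁻¹ * (qfact s)⁻¹ = qbinom (t + s) t * (qfact (t + s))⁻¹ := by
    have := qfact_ne_zero (t + s)
    rw [qbinom_add]
    field_simp
  have h2 := congrArg (C : Qq →+* Qq[T;T⁻¹]) h1
  simp only [map_mul] at h2
  simp only [laurentLusztig, Finset.prod_range_add, h]
  linear_combination (∏ i ∈ Finset.range t, laurentBracket (c - i)) *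
    (∏ i ∈ Finset.range s, laurentBracket (c - ((t + i : ℕ) : ℤ))) * h2

/-- The expansion of `[K; c choose t] [K; c + d choose s]`, where `m = t + d ≥ 0` and
`n = s - d ≥ 0`, by induction on `t`. The induction starts with `t = 0` if `d ≥ 0`, and with `m = 0`
otherwise. In the step, the new factor `[K; c - t]` is written as a combination of the two factors
that extend `[K; c + j choose m + n]` at its ends, and the coefficients are collected by
`qbinom_mul_qbinom_recursion`. -/
theorem laurentLusztig_mul_aux (c d : ℤ) (s n : ℕ) (hs : (s : ℤ) = n + d) (t : ℕ) :
    ∀ m : ℕ, (m : ℤ) = t + d → laurentLusztig c t * laurentLusztig (c + d) s =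
      ∑ j ∈ Finset.range (m + 1),
        C (qbinom m j * qbinom n (j - d)) * laurentLusztig (c + j) (t + s) := by
  induction t with
  | zero =>
    intro m hm
    obtain rfl : d = m := by simpa using hm.symm
    rw [Finset.sum_eq_single_of_mem m (by simp)]
    · simp
    · intro j hj hjm
      rw [qbinom_of_neg n (show (j : ℤ) - m < 0 by have := Finset.mem_range.1 hj; omega)]
      simp
  | succ t ih =>
    rintro (_ | m) hm
    · obtain rfl : d = -((t + 1 : ℕ) : ℤ) := by omega
      obtain rfl : n = t + 1 + s := by omega
      rw [← sub_eq_add_neg, laurentLusztig_mul_consecutive]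
      have := qbinom_self 0
      simp_all
    · have hm' : (m : ℤ) = t + d := by push_cast at hm; omega
      have ih := ih m hm'
      apply C_qint_mul_cancel (show (t : ℤ) + 1 ≠ 0 by omega)
      have hN : ((t + s : ℕ) : ℤ) = m + n := by push_cast; omega
      rw [show t + 1 + s = t + s + 1 by ring]
      let f : ℕ → Qq[T;T⁻¹] := fun j =>
        C (qbinom m j * qbinom n (j - d) * qint (m + 1 + j - d)) *
          laurentLusztig (c + j) (t + s + 1)
      let g : ℕ → Qq[T;T⁻¹] := fun j =>
        C (qbinom m (j - 1) * qbinom n (j - 1 - d) * qint (n + d - (j - 1))) *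
          laurentLusztig (c + j) (t + s + 1)
      have hf : f (m + 1) = 0 := by
        simp only [f]
        rw [qbinom_of_lt (show (m : ℤ) < ((m + 1 : ℕ) : ℤ) by omega), zero_mul, zero_mul, map_zero,
          zero_mul]
      have hg : g 0 = 0 := by
        simp only [g]
        rw [qbinom_of_neg m (show ((0 : ℕ) : ℤ) - 1 < 0 by omega), zero_mul, zero_mul, map_zero,
          zero_mul]
      have hl : C (qint (t + 1)) * (laurentLusztig c (t + 1) * laurentLusztig (c + d) s) =
          (laurentLusztig c t * laurentLusztig (c + d) s) * laurentBracket (c - t) := by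
        linear_combination laurentLusztig (c + d) s * qint_mul_laurentLusztig_succ c t
      rw [hl, ih, Finset.sum_mul, Finset.mul_sum]
      refine (Finset.sum_congr rfl fun j _ => ?_).trans
        ((sum_range_add_shift f g m hf hg).trans (Finset.sum_congr rfl fun j _ => ?_))
      · simp only [f, g]
        rw [mul_assoc, laurentLusztig_mul_bracket, hN,
          show c + (j : ℤ) + 1 - (c - t) = m + 1 + j - d by omega,
          show c - (t : ℤ) - (c + j) + (m + n) = n + d - j by omega, Nat.cast_succ,
          add_sub_cancel_right, ← add_assoc, mul_add, map_mul _ _ (qint (m + 1 + j - d)),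
          map_mul _ _ (qint (n + d - j)), mul_assoc, mul_assoc]
      · simp only [f, g]
        rw [← add_mul, ← map_add, qbinom_mul_qbinom_recursion, map_mul, mul_assoc,
          show (m : ℤ) + 1 - d = t + 1 by omega]

/-- The product formula, with the sum over the range in which the summands do not vanish. -/
theorem laurentLusztig_mul (b c : ℤ) (s t : ℕ) (h₁ : 0 ≤ (t : ℤ) - c + b)
    (h₂ : 0 ≤ (s : ℤ) - b + c) :
    laurentLusztig c t * laurentLusztig b s =
      ∑ i ∈ Finset.Icc (max b c) (min ((t : ℤ) + b) ((s : ℤ) + c)),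
        C (algebraMap A Qq (quantumBinomialInt ((t : ℤ) - c + b) (i - c) *
          quantumBinomialInt ((s : ℤ) - b + c) (i - b))) * laurentLusztig i (t + s) := by
  obtain ⟨m, hm⟩ := Int.eq_ofNat_of_zero_le h₁
  obtain ⟨n, hn⟩ := Int.eq_ofNat_of_zero_le h₂
  have h := laurentLusztig_mul_aux c (b - c) s n (by omega) t m (by omega)
  rw [add_sub_cancel] at h
  rw [h, hm, hn]
  simp only [map_mul (algebraMap A Qq)]
  change _ = ∑ i ∈ _, C (qbinom m (i - c) * qbinom n (i - b)) * _
  rw [Finset.sum_subset (s₂ := Finset.Icc c (c + m))]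
  · refine Finset.sum_nbij' (fun j => c + j) (fun i => (i - c).toNat) ?_ ?_ ?_ ?_ ?_
    · intro j hj; simp only [Finset.mem_range, Finset.mem_Icc] at hj ⊢; omega
    · intro j hj; simp only [Finset.mem_range, Finset.mem_Icc] at hj ⊢; omega
    · intro j hj; simp
    · intro j hj; simp only [Finset.mem_Icc] at hj; omega
    · intro j hj
      rw [add_sub_cancel_left, show (j : ℤ) - (b - c) = c + j - b by ring]
  · intro i hi; simp only [Finset.mem_Icc] at hi ⊢; omega
  · intro i hi hi'
    simp only [Finset.mem_Icc, not_and, not_le] at hi hi'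
    rcases lt_or_ge i b with h | h
    · rw [qbinom_of_neg n (show i - b < 0 by omega)]; simp
    · rw [qbinom_of_lt (show (n : ℤ) < i - b by have := hi' (by omega); omega)]; simp

theorem laurentBracket_mul (a b : ℤ) :
    laurentBracket a * laurentBracket b =
      C ((q - q⁻¹)⁻¹ ^ 2 * q ^ (a + b)) * T 1 ^ 2 -
        C ((q - q⁻¹)⁻¹ ^ 2 * (q ^ (a - b) + q ^ (b - a))) +
        C ((q - q⁻¹)⁻¹ ^ 2 * q ^ (-a - b)) * T (-1) ^ 2 := by
  have h : (T 1 * T (-1) : Qq[T;T⁻¹]) = 1 := by rw [← LaurentPolynomial.T_add]; simp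
  simp only [laurentBracket, sub_eq_add_neg, zpow_add₀ q_ne_zero, map_mul, map_add, map_pow]
  linear_combination (-C (q + -q⁻¹)⁻¹ ^ 2 * (C (q ^ a) * C (q ^ (-b)) + C (q ^ b) * C (q ^ (-a)))) * h

/-- The three-term relation for `t ≥ 2`. Up to the common factor `[K; c choose t - 2]` it is an
identity between products of two brackets. -/
theorem laurentLusztig_three_term (c : ℤ) (t : ℕ) :
    laurentLusztig (c + 2) (t + 2) =
      C (q ^ ((t : ℤ) + 2) + q ^ (-((t : ℤ) + 2))) * laurentLusztig (c + 1) (t + 2) -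
        laurentLusztig c (t + 2) + laurentLusztig c t := by
  apply C_qint_mul_cancel (show (t : ℤ) + 1 + 1 ≠ 0 by omega)
  apply C_qint_mul_cancel (show (t : ℤ) + 1 ≠ 0 by omega)
  have a1 := qint_mul_laurentLusztig_succ' (c + 1) (t + 1)
  have a2 := qint_mul_laurentLusztig_succ' c (t + 1)
  have a3 := qint_mul_laurentLusztig_succ c (t + 1)
  have b1 := qint_mul_laurentLusztig_succ' c t
  have b2 := qint_mul_laurentLusztig_succ c t
  push_cast at a1 a2 a3
  rw [show c + 1 + 1 = c + 2 by ring] at a1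
  have key : laurentBracket (c + 2) * laurentBracket (c + 1) +
      laurentBracket (c - (t + 1)) * laurentBracket (c - t) =
      C (q ^ ((t : ℤ) + 2) + q ^ (-((t : ℤ) + 2))) * (laurentBracket (c + 1) * laurentBracket (c - t))
        + C (qint (t + 1)) * C (qint (t + 1 + 1)) := by
    have hq := q_ne_zero
    have h1 : q ^ (c + 2 + (c + 1)) + q ^ (c - (t + 1) + (c - t)) =
        (q ^ ((t : ℤ) + 2) + q ^ (-((t : ℤ) + 2))) * q ^ (c + 1 + (c - t)) := by
      rw [add_mul, ← zpow_add₀ hq, ← zpow_add₀ hq]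
      ring_nf
    have h2 : q ^ (-(c + 2) - (c + 1)) + q ^ (-(c - (t + 1)) - (c - t)) =
        (q ^ ((t : ℤ) + 2) + q ^ (-((t : ℤ) + 2))) * q ^ (-(c + 1) - (c - t)) := by
      rw [add_mul, ← zpow_add₀ hq, ← zpow_add₀ hq]
      ring_nf
    have h3 : (q - q⁻¹)⁻¹ ^ 2 * (q ^ (c + 2 - (c + 1)) + q ^ (c + 1 - (c + 2))) +
        (q - q⁻¹)⁻¹ ^ 2 * (q ^ (c - (t + 1) - (c - t)) + q ^ (c - t - (c - (t + 1)))) =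
        (q ^ ((t : ℤ) + 2) + q ^ (-((t : ℤ) + 2))) *
          ((q - q⁻¹)⁻¹ ^ 2 * (q ^ (c + 1 - (c - t)) + q ^ (c - t - (c + 1)))) -
          qint (t + 1) * qint (t + 1 + 1) := by
      rw [show c + 2 - (c + 1) = 1 by ring, show c + 1 - (c + 2) = -1 by ring,
        show c - (t + 1 : ℤ) - (c - t) = -1 by ring, show c - t - (c - (t + 1 : ℤ)) = 1 by ring,
        show c + 1 - (c - (t : ℤ)) = t + 1 by ring, show c - (t : ℤ) - (c + 1) = -(t + 1) by ring]
      simp only [qint, zpow_neg, zpow_add₀ hq, zpow_ofNat]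
      have h1 := zpow_ne_zero t hq
      generalize (q - q⁻¹)⁻¹ = δ
      generalize q ^ (t : ℤ) = x at *
      field_simp
      ring
    have e1 := congrArg (C : Qq →+* Qq[T;T⁻¹]) h1
    have e2 := congrArg (C : Qq →+* Qq[T;T⁻¹]) h2
    have e3 := congrArg (C : Qq →+* Qq[T;T⁻¹]) h3
    simp only [laurentBracket_mul]
    simp only [map_mul, map_add, map_sub] at e1 e2 e3 ⊢
    linear_combination C ((q - q⁻¹)⁻¹ ^ 2) * T 1 ^ 2 * e1 +
      C ((q - q⁻¹)⁻¹ ^ 2) * T (-1) ^ 2 * e2 - e3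
  linear_combination C (qint (t + 1)) * a1 + laurentBracket (c + 2) * b1 -
    C (q ^ ((t : ℤ) + 2) + q ^ (-((t : ℤ) + 2))) *
      (C (qint (t + 1)) * a2 + laurentBracket (c + 1) * b2) +
    (C (qint (t + 1)) * a3 + laurentBracket (c - (t + 1)) * b2) + laurentLusztig c t * key

theorem laurentLusztig_one (c : ℤ) : laurentLusztig c 1 = laurentBracket c := by
  simpa using qint_mul_laurentLusztig_succ c 0

theorem laurentLusztig_three_term_one (c : ℤ) :
    laurentLusztig (c + 2) 1 =
      C (q + q⁻¹) * laurentLusztig (c + 1) 1 - laurentLusztig c 1 := by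
  have h := laurentBracket_mul_qint (c + 1) c (c + 2)
  have h2 : qint 2 = q + q⁻¹ := by
    have := q_sub_inv_ne_zero
    rw [qint, inv_mul_eq_iff_eq_mul₀ this, zpow_neg, zpow_ofNat, ← inv_pow]
    ring
  simp only [laurentLusztig_one]
  rw [add_sub_cancel_left, h2, show c + 2 - (c + 1) = 1 by ring, add_sub_cancel_left, qint_one,
    map_one, one_mul, one_mul] at h
  linear_combination -h

/-- A recursion for the upper parameter, with coefficients in `𝒜` up to the factor `K⁻¹ = T (-1)`. -/
theorem laurentLusztig_succ_succ (c : ℤ) (t : ℕ) :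
    laurentLusztig (c + 1) (t + 1) = C (q ^ ((t : ℤ) + 1)) * laurentLusztig c (t + 1) +
      C (q ^ (t - c)) * (T (-1) * laurentLusztig c t) := by
  apply C_qint_mul_cancel (show (t : ℤ) + 1 ≠ 0 by omega)
  have h1 := qint_mul_laurentLusztig_succ c t
  have h2 := qint_mul_laurentLusztig_succ' c t
  have key : laurentBracket (c + 1) = C (q ^ ((t : ℤ) + 1)) * laurentBracket (c - t) +
      C (qint (t + 1)) * C (q ^ (t - c)) * T (-1) := by
    have hq := q_ne_zero
    have h1 : q ^ (c + 1) = q ^ ((t : ℤ) + 1) * q ^ (c - t) := by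
      rw [← zpow_add₀ hq]
      ring_nf
    have h2 : (q - q⁻¹)⁻¹ * q ^ (-(c + 1)) =
        q ^ ((t : ℤ) + 1) * ((q - q⁻¹)⁻¹ * q ^ (-(c - t))) - qint (t + 1) * q ^ (t - c) := by
      rw [qint, neg_sub, show -(c + 1) = -((t : ℤ) + 1) + (t - c) by ring, zpow_add₀ hq]
      ring
    have e1 := congrArg (C : Qq →+* Qq[T;T⁻¹]) h1
    have e2 := congrArg (C : Qq →+* Qq[T;T⁻¹]) h2
    simp only [map_mul, map_sub C] at e1 e2
    simp only [laurentBracket]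
    linear_combination C (q - q⁻¹)⁻¹ * T 1 * e1 - T (-1) * e2
  linear_combination h2 - C (q ^ ((t : ℤ) + 1)) * h1 + laurentLusztig c t * key

/-! ### Laurent polynomials in `K` inside `U_q(sl₂)` -/

theorem K_mul_Kinv : K * Kinv = 1 := by
  have := RingQuot.mkAlgHom_rel Qq UqRel.K_mul_Kinv
  rwa [map_mul, map_one] at this

theorem Kinv_mul_K : Kinv * K = 1 := by
  have := RingQuot.mkAlgHom_rel Qq UqRel.Kinv_mul_K
  rwa [map_mul, map_one] at this

/-- The element `K` as a unit of `U_q(sl₂)`. -/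
def unitK : Uqˣ := ⟨K, Kinv, K_mul_Kinv, Kinv_mul_K⟩

/-- The homomorphism `ℚ(q)[K, K⁻¹] → U_q(sl₂)`. -/
def laurentToUq : Qq[T;T⁻¹] →ₐ[Qq] Uq :=
  AddMonoidAlgebra.lift Qq Uq ℤ ((Units.coeHom Uq).comp (zpowersHom Uqˣ unitK))

theorem laurentToUq_T (n : ℤ) : laurentToUq (T n) = ((unitK ^ n : Uqˣ) : Uq) := by
  rw [laurentToUq, T, AddMonoidAlgebra.lift_single, one_smul]
  rfl

theorem laurentToUq_T_one : laurentToUq (T 1) = K := by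
  rw [laurentToUq_T, zpow_one]; rfl

theorem laurentToUq_T_neg_one : laurentToUq (T (-1)) = Kinv := by
  rw [laurentToUq_T, zpow_neg_one]; rfl

theorem laurentToUq_C_mul (a : Qq) (f : Qq[T;T⁻¹]) :
    laurentToUq (C a * f) = a • laurentToUq f := by
  rw [← LaurentPolynomial.smul_eq_C_mul, map_smul]

theorem laurentToUq_laurentBracket (a : ℤ) : laurentToUq (laurentBracket a) = bracket a := by
  rw [laurentBracket, laurentToUq_C_mul, map_sub, laurentToUq_C_mul, laurentToUq_C_mul,
    laurentToUq_T_one, laurentToUq_T_neg_one, bracket]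

theorem laurentToUq_laurentLusztig (c : ℤ) (t : ℕ) :
    laurentToUq (laurentLusztig c t) = lusztig c t := by
  have h : ∏ i ∈ Finset.range t, laurentBracket (c - i) =
      ((List.range t).map fun i : ℕ => laurentBracket (c - i)).prod := by
    rw [Finset.prod, Finset.range_val, Multiset.range, Multiset.map_coe, Multiset.prod_coe]
  rw [laurentLusztig, laurentToUq_C_mul, h, map_list_prod, List.map_map, lusztig, qfact]
  congr 2
  -- The list of integers in `lusztig` is the list `List.range t` of natural numbers, coerced.
  have hl : (do let a ← List.range t; pure (a : ℤ)) = (List.range t).map fun a : ℕ => (a : ℤ) :=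
    List.flatMap_pure_eq_map _ _
  rw [hl, List.map_map]
  refine List.map_congr_left fun i _ => ?_
  exact laurentToUq_laurentBracket _

/-- The coefficient of the action of `E` on the universal module below. -/
def raisingCoeff (n : ℤ) : Qq[T;T⁻¹] :=
  -(C ((q - q⁻¹)⁻¹ ^ 2) * (C (q ^ (2 * n - 1)) * T (-1) + C (q ^ (1 - 2 * n)) * T 1))

/-- The action of the generators of `U_q(sl₂)` on the functions `ℤ → ℚ(q)[T, T⁻¹]`. The weights are
`q ^ (-2 n) T` with a formal parameter `T`; `F` shifts the argument by one, and the coefficient of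
`E` is determined by the commutator of `E` and `F`. -/
def genAction : Gen → Module.End Qq (ℤ → Qq[T;T⁻¹])
  | .K => LinearMap.pi fun n =>
      LinearMap.mulLeft Qq (C (q ^ (-2 * n)) * T 1) ∘ₗ LinearMap.proj n
  | .Kinv => LinearMap.pi fun n =>
      LinearMap.mulLeft Qq (C (q ^ (2 * n)) * T (-1)) ∘ₗ LinearMap.proj n
  | .E => LinearMap.pi fun n => LinearMap.mulLeft Qq (raisingCoeff (n + 1)) ∘ₗ LinearMap.proj (n + 1)
  | .F => LinearMap.pi fun n => LinearMap.proj (n - 1)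

theorem genAction_rel ⦃x y : FreeAlgebra Qq Gen⦄ (h : UqRel x y) :
    FreeAlgebra.lift Qq genAction x = FreeAlgebra.lift Qq genAction y := by
  have hT : (T 1 * T (-1) : Qq[T;T⁻¹]) = 1 := by rw [← LaurentPolynomial.T_add]; simp
  have hC : ∀ n : ℤ, (C (q ^ (-2 * n)) * C (q ^ (2 * n)) : Qq[T;T⁻¹]) = 1 := fun n => by
    rw [← map_mul, ← zpow_add₀ q_ne_zero]; simp
  cases h <;>
    simp only [map_mul, map_one, map_smul, map_sub, FreeAlgebra.lift_ι_apply] <;>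
    refine LinearMap.ext fun v => funext fun n => ?_
  · change C (q ^ (-2 * n)) * T 1 * (C (q ^ (2 * n)) * T (-1) * v n) = v n
    linear_combination v n * (hT + (T 1 * T (-1)) * hC n)
  · change C (q ^ (2 * n)) * T (-1) * (C (q ^ (-2 * n)) * T 1 * v n) = v n
    linear_combination v n * (hT + (T 1 * T (-1)) * hC n)
  · change C (q ^ (-2 * n)) * T 1 *
      (raisingCoeff (n + 1) * (C (q ^ (2 * (n + 1))) * T (-1) * v (n + 1))) =
        q ^ (2 : ℤ) • (raisingCoeff (n + 1) * v (n + 1))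
    have h2 : (C (q ^ (2 * (n + 1))) : Qq[T;T⁻¹]) = C (q ^ (2 : ℤ)) * C (q ^ (2 * n)) := by
      rw [← map_mul, ← zpow_add₀ q_ne_zero]; ring_nf
    rw [LaurentPolynomial.smul_eq_C_mul, h2]
    linear_combination C (q ^ (2 : ℤ)) * raisingCoeff (n + 1) * v (n + 1) *
      (hT + (T 1 * T (-1)) * hC n)
  · change C (q ^ (-2 * n)) * T 1 * (C (q ^ (2 * (n - 1))) * T (-1) * v (n - 1)) =
        q ^ (-2 : ℤ) • v (n - 1)
    have h2 : (C (q ^ (2 * (n - 1))) : Qq[T;T⁻¹]) = C (q ^ (-2 : ℤ)) * C (q ^ (2 * n)) := by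
      rw [← map_mul, ← zpow_add₀ q_ne_zero]; ring_nf
    rw [LaurentPolynomial.smul_eq_C_mul, h2]
    linear_combination C (q ^ (-2 : ℤ)) * v (n - 1) * (hT + (T 1 * T (-1)) * hC n)
  · change raisingCoeff (n + 1) * v (n + 1 - 1) - raisingCoeff (n - 1 + 1) * v (n - 1 + 1) =
      (q - q⁻¹)⁻¹ • (C (q ^ (-2 * n)) * T 1 * v n - C (q ^ (2 * n)) * T (-1) * v n)
    have hq := q_ne_zero
    have hd : (q - q⁻¹)⁻¹ ^ 2 * (q - q⁻¹) = (q - q⁻¹)⁻¹ := by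
      have := q_sub_inv_ne_zero
      field_simp
    have h1 : (q - q⁻¹)⁻¹ ^ 2 * (q ^ (1 - 2 * n) - q ^ (1 - 2 * (n + 1))) =
        (q - q⁻¹)⁻¹ * q ^ (-2 * n) := by
      rw [show 1 - 2 * n = 1 + -2 * n by ring, show 1 - 2 * (n + 1) = -1 + -2 * n by ring,
        zpow_add₀ hq, zpow_add₀ hq, zpow_one, zpow_neg_one]
      linear_combination q ^ (-2 * n) * hd
    have h2 : (q - q⁻¹)⁻¹ ^ 2 * (q ^ (2 * (n + 1) - 1) - q ^ (2 * n - 1)) =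
        (q - q⁻¹)⁻¹ * q ^ (2 * n) := by
      rw [show 2 * n - 1 = -1 + 2 * n by ring, show 2 * (n + 1) - 1 = 1 + 2 * n by ring,
        zpow_add₀ hq, zpow_add₀ hq, zpow_one, zpow_neg_one]
      linear_combination q ^ (2 * n) * hd
    have e1 := congrArg (C : Qq →+* Qq[T;T⁻¹]) h1
    have e2 := congrArg (C : Qq →+* Qq[T;T⁻¹]) h2
    simp only [map_mul, map_sub C] at e1 e2
    rw [LaurentPolynomial.smul_eq_C_mul, add_sub_cancel_right, sub_add_cancel]
    simp only [raisingCoeff]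
    linear_combination v n * T 1 * e1 - v n * T (-1) * e2

/-- The action of `U_q(sl₂)` on the functions `ℤ → ℚ(q)[T, T⁻¹]`. -/
def action : Uq →ₐ[Qq] Module.End Qq (ℤ → Qq[T;T⁻¹]) :=
  RingQuot.liftAlgHom Qq ⟨FreeAlgebra.lift Qq genAction, genAction_rel⟩

theorem action_gen (x : Gen) : action (Uq.gen x) = genAction x := by
  rw [action, Uq.gen, RingQuot.liftAlgHom_mkAlgHom_apply, FreeAlgebra.lift_ι_apply]

/-- On the values at `0`, a Laurent polynomial in `K` acts by multiplication with itself. -/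
theorem action_laurentToUq_zero (f : Qq[T;T⁻¹]) :
    ∀ v : ℤ → Qq[T;T⁻¹], action (laurentToUq f) v 0 = f * v 0 := by
  have hK : ∀ v : ℤ → Qq[T;T⁻¹], action K v 0 = T 1 * v 0 := fun v => by
    rw [K, action_gen]
    change C (q ^ (-2 * 0 : ℤ)) * T 1 * v 0 = _
    simp
  have hKinv : ∀ v : ℤ → Qq[T;T⁻¹], action Kinv v 0 = T (-1) * v 0 := fun v => by
    rw [Kinv, action_gen]
    change C (q ^ (2 * 0 : ℤ)) * T (-1) * v 0 = _
    simp
  induction f using LaurentPolynomial.induction_on with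
  | h_C a =>
    intro v
    rw [LaurentPolynomial.C_eq_algebraMap, AlgHom.commutes, AlgHom.commutes]
    simp [Module.algebraMap_end_apply, Algebra.smul_def]
  | h_add hf hg =>
    intro v
    simp [hf v, hg v, add_mul]
  | h_C_mul_T n a ih =>
    intro v
    rw [LaurentPolynomial.T_add, ← mul_assoc, map_mul, map_mul, Module.End.mul_apply, ih,
      laurentToUq_T_one, hK, ← mul_assoc]
  | h_C_mul_T_Z n a ih =>
    intro v
    rw [sub_eq_add_neg, LaurentPolynomial.T_add, ← mul_assoc, map_mul, map_mul,
      Module.End.mul_apply, ih, laurentToUq_T_neg_one, hKinv, ← mul_assoc]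

/-- The powers of `K` are linearly independent in `U_q(sl₂)`. -/
theorem laurentToUq_injective : Function.Injective laurentToUq := by
  intro f g h
  have := action_laurentToUq_zero f 1
  rw [h, action_laurentToUq_zero] at this
  simpa using this.symm

/-! ### Extreme coefficients -/

theorem qint_mul_coeff_laurentLusztig_succ (c : ℤ) (t : ℕ) (n : ℤ) :
    qint (t + 1) * (laurentLusztig c (t + 1)).coeff n =
      (q - q⁻¹)⁻¹ * (q ^ (c - t) * (laurentLusztig c t).coeff (n - 1) -
        q ^ (t - c) * (laurentLusztig c t).coeff (n + 1)) := by
  have hT : ∀ (f : Qq[T;T⁻¹]) (k n : ℤ), (f * T k).coeff n = f.coeff (n - k) := fun f k n => by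
    rw [T, AddMonoidAlgebra.coeff_mul_single_apply, mul_one, sub_eq_add_neg]
  have h := congrArg (fun f : Qq[T;T⁻¹] => f.coeff n) (qint_mul_laurentLusztig_succ c t)
  have e : laurentLusztig c t * laurentBracket (c - t) =
      (q - q⁻¹)⁻¹ • (q ^ (c - t) • (laurentLusztig c t * T 1) -
        q ^ (t - c) • (laurentLusztig c t * T (-1))) := by
    simp only [laurentBracket, LaurentPolynomial.smul_eq_C_mul, neg_sub]
    ring
  rw [e, ← LaurentPolynomial.smul_eq_C_mul] at h
  simpa [hT] using h

theorem coeff_laurentLusztig_of_lt (c : ℤ) (t : ℕ) :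
    ∀ n : ℤ, (t : ℤ) < |n| → (laurentLusztig c t).coeff n = 0 := by
  induction t with
  | zero =>
    intro n hn
    have : n ≠ 0 := by simpa using hn
    rw [laurentLusztig_zero, ← LaurentPolynomial.T_zero, LaurentPolynomial.T_apply, if_neg this.symm]
  | succ t ih =>
    intro n hn
    have h := qint_mul_coeff_laurentLusztig_succ c t n
    push_cast at hn
    rw [ih (n - 1) (by grind), ih (n + 1) (by grind)] at h
    simpa [qint_ne_zero (show (t : ℤ) + 1 ≠ 0 by omega)] using h

theorem qint_mul_coeff_top (c : ℤ) (t : ℕ) :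
    qint (t + 1) * (laurentLusztig c (t + 1)).coeff ((t + 1 : ℕ) : ℤ) =
      (q - q⁻¹)⁻¹ * (q ^ (c - t) * (laurentLusztig c t).coeff (t : ℤ)) := by
  rw [qint_mul_coeff_laurentLusztig_succ, coeff_laurentLusztig_of_lt c t (((t + 1 : ℕ) : ℤ) + 1)
    (by grind)]
  simp

theorem qint_mul_coeff_bottom (c : ℤ) (t : ℕ) :
    qint (t + 1) * (laurentLusztig c (t + 1)).coeff (-((t + 1 : ℕ) : ℤ)) =
      -((q - q⁻¹)⁻¹ * (q ^ (t - c) * (laurentLusztig c t).coeff (-(t : ℤ)))) := by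
  rw [qint_mul_coeff_laurentLusztig_succ, coeff_laurentLusztig_of_lt c t (-((t + 1 : ℕ) : ℤ) - 1)
    (by grind), show -((t + 1 : ℕ) : ℤ) + 1 = -t by push_cast; ring]
  ring

theorem coeff_top_ne_zero (c : ℤ) (t : ℕ) : (laurentLusztig c t).coeff (t : ℤ) ≠ 0 := by
  induction t with
  | zero => rw [laurentLusztig_zero, ← LaurentPolynomial.T_zero, LaurentPolynomial.T_apply]; simp
  | succ t ih =>
    refine right_ne_zero_of_mul (a := qint (t + 1)) ?_
    rw [qint_mul_coeff_top]
    exact mul_ne_zero (inv_ne_zero q_sub_inv_ne_zero) (mul_ne_zero (zpow_ne_zero _ q_ne_zero) ih)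

theorem coeff_bottom_ne_zero (c : ℤ) (t : ℕ) : (laurentLusztig c t).coeff (-(t : ℤ)) ≠ 0 := by
  induction t with
  | zero => rw [laurentLusztig_zero, ← LaurentPolynomial.T_zero, LaurentPolynomial.T_apply]; simp
  | succ t ih =>
    refine right_ne_zero_of_mul (a := qint (t + 1)) ?_
    rw [qint_mul_coeff_bottom]
    exact neg_ne_zero.2
      (mul_ne_zero (inv_ne_zero q_sub_inv_ne_zero) (mul_ne_zero (zpow_ne_zero _ q_ne_zero) ih))

theorem coeff_top_succ (c : ℤ) (t : ℕ) :
    (laurentLusztig (c + 1) t).coeff (t : ℤ) = q ^ (t : ℤ) * (laurentLusztig c t).coeff (t : ℤ) := by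
  induction t with
  | zero => simp
  | succ t ih =>
    apply mul_left_cancel₀ (qint_ne_zero (show (t : ℤ) + 1 ≠ 0 by omega))
    have h := qint_mul_coeff_top c t
    have e : q ^ ((t + 1 : ℕ) : ℤ) = q ^ (1 : ℤ) * q ^ (t : ℤ) := by
      rw [← zpow_add₀ q_ne_zero]; push_cast; ring_nf
    rw [qint_mul_coeff_top, ih, add_sub_right_comm, zpow_add₀ q_ne_zero, e]
    linear_combination -(q ^ (1 : ℤ) * q ^ (t : ℤ)) * h

theorem coeff_bottom_succ (c : ℤ) (t : ℕ) :
    (laurentLusztig (c + 1) t).coeff (-(t : ℤ)) =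
      q ^ (-(t : ℤ)) * (laurentLusztig c t).coeff (-(t : ℤ)) := by
  induction t with
  | zero => simp
  | succ t ih =>
    apply mul_left_cancel₀ (qint_ne_zero (show (t : ℤ) + 1 ≠ 0 by omega))
    have h := qint_mul_coeff_bottom c t
    have e : q ^ (-((t + 1 : ℕ) : ℤ)) = q ^ (-1 : ℤ) * q ^ (-(t : ℤ)) := by
      rw [← zpow_add₀ q_ne_zero]; push_cast; ring_nf
    rw [qint_mul_coeff_bottom, ih, show (t : ℤ) - (c + 1) = t - c + -1 by ring,
      zpow_add₀ q_ne_zero, e]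
    linear_combination -(q ^ (-1 : ℤ) * q ^ (-(t : ℤ))) * h

/-- The coefficients at `K ^ t` and `K ^ (-t)` separate `[K; 0 choose t]` from `[K; 1 choose t]`. -/
theorem eq_zero_of_coeff_eq_zero {a b : Qq} {t : ℕ} (ht : t ≠ 0)
    (h₁ : a * (laurentLusztig 0 t).coeff (t : ℤ) + b * (laurentLusztig 1 t).coeff (t : ℤ) = 0)
    (h₂ : a * (laurentLusztig 0 t).coeff (-(t : ℤ)) +
      b * (laurentLusztig 1 t).coeff (-(t : ℤ)) = 0) :
    a = 0 ∧ b = 0 := by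
  have e1 := coeff_top_succ 0 t
  have e2 := coeff_bottom_succ 0 t
  rw [zero_add] at e1 e2
  rw [e1] at h₁
  rw [e2] at h₂
  have h3 : a + b * q ^ (t : ℤ) = 0 :=
    mul_right_cancel₀ (coeff_top_ne_zero 0 t) (by linear_combination h₁)
  have h4 : a + b * q ^ (-(t : ℤ)) = 0 :=
    mul_right_cancel₀ (coeff_bottom_ne_zero 0 t) (by linear_combination h₂)
  have hb : b = 0 := by
    apply mul_right_cancel₀ (zpow_sub_zpow_neg_ne_zero (show (t : ℤ) ≠ 0 by exact_mod_cast ht))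
    linear_combination h3 - h4
  exact ⟨by simpa [hb] using h3, hb⟩

/-! ### The presented algebra -/

theorem gen_zero (c : ℤ) : PresentedCartan.gen c 0 = 1 := by
  have h := RingQuot.mkAlgHom_rel A (CartanRel.one c)
  rw [map_one] at h
  exact h

theorem gen_mul_gen (b c : ℤ) (s t : ℕ) (h₁ : 0 ≤ (t : ℤ) - c + b) (h₂ : 0 ≤ (s : ℤ) - b + c) :
    PresentedCartan.gen c t * PresentedCartan.gen b s =
      ∑ i ∈ Finset.Icc (max b c) (min ((t : ℤ) + b) ((s : ℤ) + c)),
        (quantumBinomialInt ((t : ℤ) - c + b) (i - c) *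
          quantumBinomialInt ((s : ℤ) - b + c) (i - b)) • PresentedCartan.gen i (t + s) := by
  have h := RingQuot.mkAlgHom_rel A (CartanRel.mul b c s t h₁ h₂)
  simp only [map_mul, map_sum, map_smul] at h
  exact h

theorem gen_add_two (c : ℤ) (t : ℕ) (ht : 1 ≤ t) :
    PresentedCartan.gen (c + 2) t =
      (T (t : ℤ) + T (-(t : ℤ)) : A) • PresentedCartan.gen (c + 1) t - PresentedCartan.gen c t +
        if 2 ≤ t then PresentedCartan.gen c (t - 2) else 0 := by
  have h := RingQuot.mkAlgHom_rel A (CartanRel.three_term c t ht)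
  rw [map_add, map_sub, map_smul] at h
  split_ifs at h ⊢
  · exact h
  · rw [map_zero] at h
    exact h

/-- The `𝒜`-span of the generators `x_{0,t}` and `x_{1,t}` with `t < N`. -/
def basicSpan (N : ℕ) : Submodule A PresentedCartan :=
  Submodule.span A {x | ∃ t < N, x = PresentedCartan.gen 0 t ∨ x = PresentedCartan.gen 1 t}

theorem basicSpan_mono {M N : ℕ} (h : M ≤ N) : basicSpan M ≤ basicSpan N :=
  Submodule.span_mono fun _ ⟨t, ht, hx⟩ => ⟨t, ht.trans_le h, hx⟩

theorem sub_mem_basicSpan {N : ℕ} {x y : PresentedCartan} (hx : x ∈ basicSpan N)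
    (hy : y ∈ basicSpan N) : x - y ∈ basicSpan N := by
  have e : x - y = x + (-1 : A) • y := by module
  exact e ▸ add_mem hx (Submodule.smul_mem _ _ hy)

theorem gen_mem_basicSpan (t : ℕ) : ∀ c : ℤ, PresentedCartan.gen c t ∈ basicSpan (t + 1) := by
  induction t using Nat.strong_induction_on with
  | _ t ih =>
    have h0 : PresentedCartan.gen 0 t ∈ basicSpan (t + 1) :=
      Submodule.subset_span ⟨t, t.lt_succ_self, .inl rfl⟩
    have h1 : PresentedCartan.gen 1 t ∈ basicSpan (t + 1) :=
      Submodule.subset_span ⟨t, t.lt_succ_self, .inr rfl⟩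
    rcases Nat.eq_zero_or_pos t with rfl | ht
    · intro c
      rw [gen_zero] at h0 ⊢
      exact h0
    have low : ∀ c : ℤ, (if 2 ≤ t then PresentedCartan.gen c (t - 2) else 0) ∈
        basicSpan (t + 1) := fun c => by
      split_ifs
      · exact basicSpan_mono (by omega) (ih (t - 2) (by omega) c)
      · exact Submodule.zero_mem _
    -- Two neighbouring generators determine all others, upwards and downwards.
    have key : ∀ c : ℤ, PresentedCartan.gen c t ∈ basicSpan (t + 1) ∧
        PresentedCartan.gen (c + 1) t ∈ basicSpan (t + 1) := by
      intro c
      induction c using Int.induction_on with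
      | zero => exact ⟨h0, h1⟩
      | succ c ih =>
        refine ⟨ih.2, ?_⟩
        rw [add_assoc, one_add_one_eq_two, gen_add_two _ t ht]
        exact add_mem (sub_mem_basicSpan (Submodule.smul_mem _ _ ih.2) ih.1) (low _)
      | pred c ih =>
        refine ⟨?_, by simpa using ih.1⟩
        have h := gen_add_two (-(c : ℤ) - 1) t ht
        rw [show -(c : ℤ) - 1 + 2 = -c + 1 by ring, sub_add_cancel] at h
        have h' : PresentedCartan.gen (-(c : ℤ) - 1) t =
            (T (t : ℤ) + T (-(t : ℤ)) : A) • PresentedCartan.gen (-(c : ℤ)) t -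
              PresentedCartan.gen (-(c : ℤ) + 1) t +
              if 2 ≤ t then PresentedCartan.gen (-(c : ℤ) - 1) (t - 2) else 0 := by
          rw [h]; abel
        rw [h']
        exact add_mem (sub_mem_basicSpan (Submodule.smul_mem _ _ ih.1) ih.2) (low _)
    exact fun c => (key c).1

/-- The product formula applies to generators with upper parameters in `{0, 1}` as soon as `s` and `t`
are positive; the generators with `t = 0` are `1`. -/
theorem mul_mem_basicSpan {M N : ℕ} {x y : PresentedCartan} (hx : x ∈ basicSpan M)
    (hy : y ∈ basicSpan N) : x * y ∈ basicSpan (M + N) := by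
  induction hx, hy using Submodule.span_induction₂ with
  | mem_mem x y hx hy =>
    obtain ⟨t, ht, hx⟩ := hx
    obtain ⟨s, hs, hy⟩ := hy
    rcases Nat.eq_zero_or_pos t with rfl | ht0
    · have : x = 1 := by rcases hx with rfl | rfl <;> exact gen_zero _
      rw [this, one_mul]
      exact basicSpan_mono (by omega) (Submodule.subset_span ⟨s, hs, hy⟩)
    rcases Nat.eq_zero_or_pos s with rfl | hs0
    · have : y = 1 := by rcases hy with rfl | rfl <;> exact gen_zero _
      rw [this, mul_one]
      exact basicSpan_mono (by omega) (Submodule.subset_span ⟨t, ht, hx⟩)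
    obtain ⟨c, hc, rfl⟩ : ∃ c : ℤ, (c = 0 ∨ c = 1) ∧ x = PresentedCartan.gen c t := by
      rcases hx with rfl | rfl
      exacts [⟨0, .inl rfl, rfl⟩, ⟨1, .inr rfl, rfl⟩]
    obtain ⟨b, hb, rfl⟩ : ∃ b : ℤ, (b = 0 ∨ b = 1) ∧ y = PresentedCartan.gen b s := by
      rcases hy with rfl | rfl
      exacts [⟨0, .inl rfl, rfl⟩, ⟨1, .inr rfl, rfl⟩]
    rw [gen_mul_gen b c s t (by omega) (by omega)]
    exact sum_mem fun i _ => Submodule.smul_mem _ _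
      (basicSpan_mono (by omega) (gen_mem_basicSpan (t + s) i))
  | zero_left y hy => simp
  | zero_right x hx => simp
  | add_left x y z hx hy hz h1 h2 => rw [add_mul]; exact add_mem h1 h2
  | add_right x y z hx hy hz h1 h2 => rw [mul_add]; exact add_mem h1 h2
  | smul_left r x y hx hy h => rw [smul_mul_assoc]; exact Submodule.smul_mem _ _ h
  | smul_right r x y hx hy h => rw [mul_smul_comm]; exact Submodule.smul_mem _ _ h

theorem one_mem_basicSpan : (1 : PresentedCartan) ∈ basicSpan 1 := by
  rw [← gen_zero 0]; exact gen_mem_basicSpan 0 0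

theorem exists_mem_basicSpan (x : PresentedCartan) : ∃ N, x ∈ basicSpan N := by
  obtain ⟨x, rfl⟩ := RingQuot.mkAlgHom_surjective A CartanRel x
  induction x using FreeAlgebra.induction with
  | grade0 r =>
    refine ⟨1, ?_⟩
    rw [AlgHom.commutes, Algebra.algebraMap_eq_smul_one]
    exact Submodule.smul_mem _ _ one_mem_basicSpan
  | grade1 p => exact ⟨p.2 + 1, gen_mem_basicSpan p.2 p.1⟩
  | mul x y hx hy =>
    obtain ⟨M, hM⟩ := hx
    obtain ⟨N, hN⟩ := hy
    exact ⟨M + N, by rw [map_mul]; exact mul_mem_basicSpan hM hN⟩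
  | add x y hx hy =>
    obtain ⟨M, hM⟩ := hx
    obtain ⟨N, hN⟩ := hy
    exact ⟨M + N, by
      rw [map_add]
      exact add_mem (basicSpan_mono (by omega) hM) (basicSpan_mono (by omega) hN)⟩

/-- An element of `basicSpan (N + 1)` is a combination of `x_{0,N}` and `x_{1,N}` plus an element of
`basicSpan N`. -/
theorem exists_of_mem_basicSpan_succ {N : ℕ} {x : PresentedCartan} (hx : x ∈ basicSpan (N + 1)) :
    ∃ a b : A, ∃ y ∈ basicSpan N,
      x = a • PresentedCartan.gen 0 N + b • PresentedCartan.gen 1 N + y := by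
  induction hx using Submodule.span_induction with
  | mem x hx =>
    obtain ⟨t, ht, hx⟩ := hx
    rcases Nat.lt_succ_iff_lt_or_eq.1 ht with ht | rfl
    · exact ⟨0, 0, x, Submodule.subset_span ⟨t, ht, hx⟩, by simp⟩
    · rcases hx with rfl | rfl
      · exact ⟨1, 0, 0, Submodule.zero_mem _, by simp⟩
      · exact ⟨0, 1, 0, Submodule.zero_mem _, by simp⟩
  | zero => exact ⟨0, 0, 0, Submodule.zero_mem _, by simp⟩
  | add x y _ _ hx hy =>
    obtain ⟨a, b, u, hu, rfl⟩ := hx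
    obtain ⟨a', b', u', hu', rfl⟩ := hy
    exact ⟨a + a', b + b', u + u', add_mem hu hu', by rw [add_smul, add_smul]; abel⟩
  | smul r x _ hx =>
    obtain ⟨a, b, u, hu, rfl⟩ := hx
    exact ⟨r * a, r * b, r • u, Submodule.smul_mem _ _ hu, by simp only [smul_add, mul_smul]⟩

/-! ### The comparison -/

theorem smul_laurent (a : A) (f : Qq[T;T⁻¹]) : a • f = C (algebraMap A Qq a) * f := by
  rw [← LaurentPolynomial.smul_eq_C_mul, algebraMap_smul]

theorem lift_laurentLusztig_rel ⦃x y : FreeAlgebra A (ℤ × ℕ)⦄ (h : CartanRel x y) :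
    FreeAlgebra.lift A (fun p : ℤ × ℕ => laurentLusztig p.1 p.2) x =
      FreeAlgebra.lift A (fun p : ℤ × ℕ => laurentLusztig p.1 p.2) y := by
  have hg : ∀ c t, FreeAlgebra.lift A (fun p : ℤ × ℕ => laurentLusztig p.1 p.2) (freeGen c t) =
      laurentLusztig c t := fun c t => FreeAlgebra.lift_ι_apply _ _
  cases h with
  | one c => rw [hg, map_one, laurentLusztig_zero]
  | mul b c s t h₁ h₂ =>
    simp only [map_mul, map_sum, map_smul, hg, smul_laurent]
    rw [laurentLusztig_mul b c s t h₁ h₂]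
    simp only [map_mul]
  | three_term c t ht =>
    rw [map_add, map_sub, map_smul, hg, hg, hg, smul_laurent, map_add, algebraMap_T, algebraMap_T]
    obtain rfl | ⟨t, rfl⟩ : t = 1 ∨ ∃ k, t = k + 2 := by
      rcases eq_or_lt_of_le ht with h | h
      exacts [.inl h.symm, .inr ⟨t - 2, by omega⟩]
    · simpa using laurentLusztig_three_term_one c
    · rw [if_pos (by omega), hg, Nat.add_sub_cancel]
      exact_mod_cast laurentLusztig_three_term c t

/-- The homomorphism from the presented algebra to `ℚ(q)[K, K⁻¹]`. -/
def toLaurent : PresentedCartan →ₐ[A] Qq[T;T⁻¹] :=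
  RingQuot.liftAlgHom A ⟨FreeAlgebra.lift A fun p : ℤ × ℕ => laurentLusztig p.1 p.2,
    lift_laurentLusztig_rel⟩

theorem toLaurent_gen (c : ℤ) (t : ℕ) :
    toLaurent (PresentedCartan.gen c t) = laurentLusztig c t := by
  rw [toLaurent, PresentedCartan.gen, RingQuot.liftAlgHom_mkAlgHom_apply]
  exact FreeAlgebra.lift_ι_apply _ _

theorem coeff_smul_laurent (a : A) (f : Qq[T;T⁻¹]) (n : ℤ) :
    (a • f).coeff n = algebraMap A Qq a * f.coeff n := by
  rw [← algebraMap_smul Qq a f]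
  rfl

theorem coeff_toLaurent_of_le {N : ℕ} {x : PresentedCartan} (hx : x ∈ basicSpan N) {n : ℤ}
    (hn : (N : ℤ) ≤ |n|) : (toLaurent x).coeff n = 0 := by
  induction hx using Submodule.span_induction with
  | mem x hx =>
    obtain ⟨t, ht, rfl | rfl⟩ := hx <;>
      exact toLaurent_gen _ t ▸ coeff_laurentLusztig_of_lt _ t n (by omega)
  | zero => simp
  | add x y _ _ hx hy => rw [map_add, AddMonoidAlgebra.coeff_add, Finsupp.add_apply, hx, hy, add_zero]
  | smul r x _ hx => rw [map_smul, coeff_smul_laurent, hx, mul_zero]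

/-- The descent on the number of levels: the extreme coefficients determine the components at the
top level, which then vanish. -/
theorem eq_zero_of_toLaurent_eq_zero (N : ℕ) :
    ∀ x ∈ basicSpan N, toLaurent x = 0 → x = 0 := by
  induction N with
  | zero =>
    intro x hx _
    simpa [basicSpan] using hx
  | succ N ih =>
    intro x hx h0
    obtain ⟨a, b, y, hy, rfl⟩ := exists_of_mem_basicSpan_succ hx
    have hc : ∀ n : ℤ, (N : ℤ) ≤ |n| → algebraMap A Qq a * (laurentLusztig 0 N).coeff n +
        algebraMap A Qq b * (laurentLusztig 1 N).coeff n = 0 := by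
      intro n hn
      have h := congrArg (fun f : Qq[T;T⁻¹] => f.coeff n) h0
      simpa only [map_add, map_smul, toLaurent_gen, AddMonoidAlgebra.coeff_add, Finsupp.add_apply,
        coeff_smul_laurent, coeff_toLaurent_of_le hy hn, add_zero, AddMonoidAlgebra.coeff_zero,
        Finsupp.zero_apply] using h
    have h1 := hc N (by simp)
    have hab : a • PresentedCartan.gen 0 N + b • PresentedCartan.gen 1 N = 0 := by
      rcases Nat.eq_zero_or_pos N with rfl | hN
      · -- Here both generators are `1`, so that only the sum of the coefficients matters.
        have h2 := coeff_top_ne_zero 0 0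
        simp only [laurentLusztig_zero, ← add_mul, ← map_add] at h1 h2
        have h3 := (map_eq_zero_iff _ inclusion_injective).1 ((mul_eq_zero.1 h1).resolve_right h2)
        rw [gen_zero, gen_zero, ← add_smul, h3, zero_smul]
      · obtain ⟨ha, hb⟩ := eq_zero_of_coeff_eq_zero hN.ne' h1 (hc (-N) (by simp))
        rw [(map_eq_zero_iff _ inclusion_injective).1 ha,
          (map_eq_zero_iff _ inclusion_injective).1 hb, zero_smul, zero_smul, add_zero]
    rw [hab, zero_add] at h0 ⊢
    exact ih y hy h0

theorem toLaurent_injective : Function.Injective toLaurent := by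
  rw [injective_iff_map_eq_zero]
  intro x hx
  obtain ⟨N, hN⟩ := exists_mem_basicSpan x
  exact eq_zero_of_toLaurent_eq_zero N x hN hx

/-- The homomorphism from the presented algebra to `U_q(sl₂)`. -/
def toUq : PresentedCartan →ₐ[A] Uq := (laurentToUq.restrictScalars A).comp toLaurent

theorem toUq_gen (c : ℤ) (t : ℕ) : toUq (PresentedCartan.gen c t) = lusztig c t := by
  change laurentToUq (toLaurent _) = _
  rw [toLaurent_gen, laurentToUq_laurentLusztig]

theorem toUq_injective : Function.Injective toUq :=
  laurentToUq_injective.comp toLaurent_injective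

theorem lusztig_succ_succ (c : ℤ) (t : ℕ) :
    lusztig (c + 1) (t + 1) = (T ((t : ℤ) + 1) : A) • lusztig c (t + 1) +
      (T ((t : ℤ) - c) : A) • (Kinv * lusztig c t) := by
  have h := congrArg laurentToUq (laurentLusztig_succ_succ c t)
  rw [map_add, laurentToUq_C_mul, laurentToUq_C_mul, map_mul, laurentToUq_T_neg_one,
    laurentToUq_laurentLusztig, laurentToUq_laurentLusztig, laurentToUq_laurentLusztig] at h
  rw [h, ← algebraMap_smul Qq (T ((t : ℤ) + 1) : A), ← algebraMap_smul Qq (T ((t : ℤ) - c) : A),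
    algebraMap_T, algebraMap_T]

theorem lusztig_zero_right (c : ℤ) : lusztig c 0 = 1 := by
  rw [← laurentToUq_laurentLusztig, laurentLusztig_zero, map_one]

theorem lusztig_mem_cartan (t : ℕ) : ∀ c : ℤ, lusztig c t ∈ cartan := by
  have hinv : Kinv ∈ cartan := Algebra.subset_adjoin (by simp)
  induction t with
  | zero =>
    intro c
    rw [lusztig_zero_right]
    exact one_mem _
  | succ t ih =>
    have hlow : ∀ c : ℤ, (T ((t : ℤ) - c) : A) • (Kinv * lusztig c t) ∈ cartan := fun c =>
      cartan.smul_mem (mul_mem hinv (ih c)) _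
    intro c
    induction c using Int.induction_on with
    | zero => exact Algebra.subset_adjoin (.inr ⟨t + 1, rfl⟩)
    | succ c ihc =>
      rw [lusztig_succ_succ]
      exact add_mem (cartan.smul_mem ihc _) (hlow _)
    | pred c ihc =>
      have h := lusztig_succ_succ (-(c : ℤ) - 1) t
      rw [sub_add_cancel] at h
      have h' : lusztig (-(c : ℤ) - 1) (t + 1) = (T (-((t : ℤ) + 1)) : A) •
          (lusztig (-(c : ℤ)) (t + 1) -
            (T ((t : ℤ) - (-(c : ℤ) - 1)) : A) • (Kinv * lusztig (-(c : ℤ) - 1) t)) := by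
        rw [h, add_sub_cancel_right, smul_smul, ← LaurentPolynomial.T_add, neg_add_cancel,
          LaurentPolynomial.T_zero, one_smul]
      rw [h']
      exact cartan.smul_mem (sub_mem ihc (hlow _)) _

theorem Kinv_eq : Kinv = lusztig 1 1 - (T 1 : A) • lusztig 0 1 := by
  have h := lusztig_succ_succ 0 0
  rw [lusztig_zero_right, mul_one] at h
  simp only [Nat.cast_zero, zero_add, sub_zero, LaurentPolynomial.T_zero, one_smul] at h
  rw [h, add_sub_cancel_left]

theorem K_eq : K = (T 1 - T (-1) : A) • lusztig 0 1 + Kinv := by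
  rw [← algebraMap_smul Qq, map_sub, algebraMap_T, algebraMap_T, ← laurentToUq_laurentLusztig,
    laurentLusztig_one, laurentToUq_laurentBracket, bracket, smul_smul, zpow_one, zpow_neg_one,
    mul_inv_cancel₀ q_sub_inv_ne_zero]
  simp

theorem range_toUq : toUq.range = cartan := by
  apply le_antisymm
  · rintro _ ⟨x, rfl⟩
    obtain ⟨x, rfl⟩ := RingQuot.mkAlgHom_surjective A CartanRel x
    induction x using FreeAlgebra.induction with
    | grade0 r => simp
    | grade1 p =>
      have := toUq_gen p.1 p.2
      exact this ▸ lusztig_mem_cartan p.2 p.1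
    | mul x y hx hy => simpa using mul_mem hx hy
    | add x y hx hy => simpa using add_mem hx hy
  · have hl : ∀ c t, lusztig c t ∈ toUq.range := fun c t => ⟨_, toUq_gen c t⟩
    have hKinv : Kinv ∈ toUq.range := by
      rw [Kinv_eq]
      exact sub_mem (hl _ _) (Subalgebra.smul_mem _ (hl _ _) _)
    refine Algebra.adjoin_le ?_
    rintro _ ((rfl | rfl) | ⟨t, rfl⟩)
    · rw [K_eq]
      exact add_mem (Subalgebra.smul_mem _ (hl _ _) _) hKinv
    · exact hKinv
    · exact hl 0 t

end

end QuantumCartan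

theorem theorem5 :
    ∃ e : QuantumCartan.PresentedCartan ≃ₐ[QuantumCartan.A] QuantumCartan.cartan,
      ∀ (c : ℤ) (t : ℕ),
        (e (QuantumCartan.PresentedCartan.gen c t) : QuantumCartan.Uq) =
          QuantumCartan.lusztig c t :=
  ⟨(AlgEquiv.ofInjective _ QuantumCartan.toUq_injective).trans
    (Subalgebra.equivOfEq _ _ QuantumCartan.range_toUq), fun c t => QuantumCartan.toUq_gen c t⟩
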